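/- Let $d\ge 1$, $s\ge 0$ be integers, let $\mu,L>0$, put $R=L/(2\mu)$ and $e_0=L^2/(8\mu)$, and let $\mathcal D_r,\mathcal D_f$ be Borel probability measures on $\mathbb R^s$. *Losses.* For $\ell:\mathbb R^d\times\mathbb R^s\to\mathbb R$ let $\mathcal L_r(\theta)=\mathbb E_{\xi\sim\mathcal D_r}[\ell(\theta,\xi)]$ and $\mathcal L_r^*=\inf_{\theta\in\mathbb R^d}\mathcal L_r(\theta)$. Let $\mathcal F_{sc}$ be the class of measurable $\ell$ such that, for every $\xi\in\mathbb R^s$, $\ell(\cdot,\xi)$ is differentiable on $\mathbb R^d$ and is $L$-Lipschitz and $\mu$-strongly convex on the closed Euclidean ball $\mathbb B(0,R)$, and such that $\mathcal L_r$ is finite ($\ell(\theta,\cdot)$ is integrable for every $\theta$) and attains its minimum over $\mathbb R^d$ at a point of $\mathbb B(0,R)$. *Algorithms.* Let $\mathbb A$ be the class of randomized iterative first-order algorithms: an algorithm $\mathcal A$ is given by a measurable memory space $M$ with an initial state $m_0$, a random seed $\omega$ with some law, and a measurable update rule $A$. Started at $\theta_0=0$, it sets $(\theta_{t+1},m_{t+1})=A(\theta_t,\nabla_\theta\ell(\theta_t,\xi_t),m_t,\omega)$,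 where $\xi_0,\xi_1,\dots$ are i.i.d. with law $\mathcal D_r$ and independent of $\omega$. Its output after $T$ steps is $\theta_T$. *Retraining time.* For $e>0$, let $T^S_e(\ell,\mathcal A)\in\mathbb N\cup\{\infty\}$ be the least $T$ such that $\mathbb E[\mathcal L_r(\theta_{T'})-\mathcal L_r^*]\le e$ for all $T'\ge T$, that is, the number of steps after which the expected excess risk is at most $e$. The minimax retraining time is $T^S_e=\inf_{\mathcal A\in\mathbb A}\sup_{\ell\in\mathcal F_{sc}}T^S_e(\ell,\mathcal A)$. *Flexible distributions.* Assume that for every $p\in[0,1]$ there is a measurable $A\subset\mathbb R^s$ with $\mathcal D_r(A)=p$, and that there is a probability measure $\mathcal D_f'$ on $\mathbb R^s$ such that the supports of $\mathcal D_r$, $\mathcal D_f$ and $\mathcal D_f'$ are pairwise disjoint. Then, if $0<e<e_0$, the minimax retraining time is finite and $$T^S_e=\Theta\!\left(\frac{e_0}{e}\right),$$ that is, $c\,e_0/e\le T^S_e\le C\,e_0/e$ with universal constants $c,C>0$ (independent of $d,s,\mu,L,e,\mathcal D_r,\mathcal D_f$). -/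

import Mathlib

open MeasureTheory

/-- `ℝⁿ` with its Euclidean norm. -/
abbrev Euc (n : ℕ) : Type := EuclideanSpace ℝ (Fin n)

/-- The objective `𝓛_r(θ) = 𝔼_{ξ ∼ D} ℓ(θ, ξ)`. -/
noncomputable def risk {d s : ℕ} (D : Measure (Euc s)) (ℓ : Euc d → Euc s → ℝ) (θ : Euc d) : ℝ :=
  ∫ ξ, ℓ θ ξ ∂D

/-- The class of losses `ℓ : ℝᵈ × ℝˢ → ℝ` that are, for every data point `ξ`, differentiable in `θ`
and both `L`-Lipschitz and `μ`-strongly convex on the closed ball of radius `R = L / (2 μ)` centred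
at the origin. The last two fields say that the objective over `D` is well posed: it is finite, and
its minimum over `ℝᵈ` is attained in the ball where the regularity holds (this is automatic
when every `ℓ(·, ξ)` is also convex on all of `ℝᵈ`). -/
structure StronglyConvexLoss {d s : ℕ} (μ L : ℝ) (D : Measure (Euc s))
    (ℓ : Euc d → Euc s → ℝ) : Prop where
  measurable : Measurable (Function.uncurry ℓ)
  differentiable : ∀ ξ, Differentiable ℝ (fun θ => ℓ θ ξ)
  lipschitz : ∀ ξ, ∀ θ ∈ Metric.closedBall (0 : Euc d) (L / (2 * μ)),
    ∀ θ' ∈ Metric.closedBall (0 : Euc d) (L / (2 * μ)), |ℓ θ ξ - ℓ θ' ξ| ≤ L * ‖θ - θ'‖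
  stronglyConvex : ∀ ξ, ∀ θ ∈ Metric.closedBall (0 : Euc d) (L / (2 * μ)),
    ∀ θ' ∈ Metric.closedBall (0 : Euc d) (L / (2 * μ)),
      ℓ θ ξ + inner ℝ (gradient (fun η => ℓ η ξ) θ) (θ' - θ) + μ / 2 * ‖θ' - θ‖ ^ 2 ≤ ℓ θ' ξ
  integrable : ∀ θ, Integrable (ℓ θ) D
  exists_minimizer : ∃ θr ∈ Metric.closedBall (0 : Euc d) (L / (2 * μ)),
    ∀ θ, risk D ℓ θr ≤ risk D ℓ θ

/-- A randomized iterative first-order algorithm on `ℝᵈ`: a memory space with an initial memory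
state, a random seed, and a measurable update rule
`(θ_t, ∇_t, m_t, ω) ↦ (θ_{t+1}, m_{t+1})`. -/
structure FirstOrderAlgorithm (d : ℕ) where
  Mem : Type
  [memMeasurable : MeasurableSpace Mem]
  initMem : Mem
  Seed : Type
  [seedMeasurable : MeasurableSpace Seed]
  seedLaw : Measure Seed
  [seedProb : IsProbabilityMeasure seedLaw]
  update : Euc d × Euc d × Mem × Seed → Euc d × Mem
  measurable_update : Measurable update

attribute [instance] FirstOrderAlgorithm.memMeasurable FirstOrderAlgorithm.seedMeasurable
  FirstOrderAlgorithm.seedProb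

namespace FirstOrderAlgorithm

/-- Model and memory `(θ_t, m_t)` after `t` steps from `θ_0 = 0`, on the loss `ℓ`, with data points
`ξ 0, ξ 1, …` and seed `ω`. Step `t` uses the single stochastic gradient `∇ℓ(θ_t, ξ_t)`. -/
noncomputable def state {d s : ℕ} (A : FirstOrderAlgorithm d) (ℓ : Euc d → Euc s → ℝ)
    (ξ : ℕ → Euc s) (ω : A.Seed) : ℕ → Euc d × A.Mem
  | 0 => (0, A.initMem)
  | t + 1 =>
      A.update ((A.state ℓ ξ ω t).1,
        gradient (fun θ => ℓ θ (ξ t)) (A.state ℓ ξ ω t).1, (A.state ℓ ξ ω t).2, ω)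

/-- The expected excess risk `𝔼[𝓛_r(θ_T) - 𝓛_r^*]` of the model returned after `T` steps, when the
data points are i.i.d. with law `D` and independent of the seed. It takes values in `[0, ∞]`, as the
integrand is nonnegative for every loss of the class. -/
noncomputable def expectedExcess {d s : ℕ} (A : FirstOrderAlgorithm d) (D : Measure (Euc s))
    [IsProbabilityMeasure D] (ℓ : Euc d → Euc s → ℝ) (T : ℕ) : ENNReal :=
  ∫⁻ x : (ℕ → Euc s) × A.Seed,
    ENNReal.ofReal (risk D ℓ (A.state ℓ x.1 x.2 T).1 - ⨅ θ : Euc d, risk D ℓ θ)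
    ∂((Measure.infinitePi (fun _ : ℕ => D)).prod A.seedLaw)

/-- The number of steps that `A` needs on the loss `ℓ` to bring its expected excess risk down to
`e`: the least `T` such that the expected excess risk is at most `e` from step `T` on
(`⊤` if there is none). -/
noncomputable def retrainTime {d s : ℕ} (A : FirstOrderAlgorithm d) (D : Measure (Euc s))
    [IsProbabilityMeasure D] (e : ℝ) (ℓ : Euc d → Euc s → ℝ) : ℕ∞ :=
  ⨅ (T : ℕ) (_ : ∀ T' : ℕ, T ≤ T' → A.expectedExcess D ℓ T' ≤ ENNReal.ofReal e), (T : ℕ∞)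

end FirstOrderAlgorithm

/-- The minimax retraining time: infimum over all algorithms of the supremum over all losses of the
class of the number of steps needed to reach expected excess risk `e`. -/
noncomputable def minimaxRetrainTime (d : ℕ) {s : ℕ} (μ L : ℝ) (D : Measure (Euc s))
    [IsProbabilityMeasure D] (e : ℝ) : ℕ∞ :=
  ⨅ A : FirstOrderAlgorithm d, ⨆ (ℓ : Euc d → Euc s → ℝ) (_ : StronglyConvexLoss μ L D ℓ),
    A.retrainTime D e ℓ

/-- The flexible-distributions assumption on the retain law `Dr` and the forget law `Df`. -/
def FlexibleDistributions {s : ℕ} (Dr Df : Measure (Euc s)) : Prop :=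
  (∀ p ∈ Set.Icc (0 : ℝ) 1, ∃ A : Set (Euc s), MeasurableSet A ∧ Dr A = ENNReal.ofReal p) ∧
  ∃ Df' : Measure (Euc s), IsProbabilityMeasure Df' ∧
    Disjoint Dr.support Df.support ∧ Disjoint Dr.support Df'.support ∧
    Disjoint Df.support Df'.support

/-! Write x = e₀/e, with e₀ = L²/(8μ). The two bounds are proved independently, and both hold up to
constants that the last theorem makes explicit.

Upper bound: run stochastic gradient descent projected on the ball, with steps 2/(μ(t+2)), and
output the average of the first N iterates with weights proportional to t+1. Expanding the squared
distance to the minimizer gives a one-step recursion (`projSGD_recursion`), because the sample ξ_t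
is independent of θ_t and the mean gradient is a strong subgradient of the risk. The recursion
telescopes (`sum_weighted_le_of_recursion`), and Jensen's inequality gives expected excess at most
2L²/(μ(N+1)) = 16 e₀/(N+1). The infimum over algorithms is taken at fixed e, so N may depend on e,
and the algorithm can freeze its output once it is good enough.

Lower bound: this is Le Cam's two-point method. For a unit vector u, the losses μ/2‖θ‖² ± (L/2)⟨u,
θ⟩, with the sign read off a bit of the data point, give an oracle that reveals nothing but that
bit. If the bit has bias ε or -ε, the minimizers are -(Lε/(2μ))u and (Lε/(2μ))u, so the two excess
risks sum to at least 2e₀ε² at every θ. The T-bit laws have Bhattacharyya coefficient (1-ε²)^(T/2),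
hence a large overlap while Tε² is small (`one_sub_sqrt_le_sum_min_prod`). On the overlap no
algorithm does well on both losses (`le_expectedExcess_add_expectedExcess`). Taking ε² = 4e/e₀
excludes T < x/16. The flexibility assumption supplies the event of probability (1+ε)/2 that defines
the bit. -/

/-! ### Gradients: norm bound and joint measurability. -/

section Gradient

variable {E : Type*} [NormedAddCommGroup E] [InnerProductSpace ℝ E] [CompleteSpace E]

theorem tendsto_slope_inner_gradient {f : E → ℝ} {x : E} (hf : DifferentiableAt ℝ f x) (v : E) :
    Filter.Tendsto (fun t : ℝ => t⁻¹ * (f (x + t • v) - f x)) (nhdsWithin 0 (Set.Ioi 0))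
      (nhds (inner ℝ (gradient f x) v)) := by
  have h1 : HasFDerivAt f (InnerProductSpace.toDual ℝ E (gradient f x)) x :=
    hf.hasGradientAt.hasFDerivAt
  have h2 : HasDerivAt (fun t : ℝ => x + t • v) v 0 := by
    simpa using ((hasDerivAt_id (0 : ℝ)).smul_const v).const_add x
  have h3 : HasDerivAt (fun t : ℝ => f (x + t • v)) (inner ℝ (gradient f x) v) 0 := by
    have h1' : HasFDerivAt f (InnerProductSpace.toDual ℝ E (gradient f x)) (x + (0 : ℝ) • v) := by
      simpa using h1
    exact h1'.comp_hasDerivAt (0 : ℝ) h2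
  simpa using h3.tendsto_slope_zero_right

/-- The gradient of a function that is Lipschitz on a closed ball is bounded by the Lipschitz
constant, up to the boundary of the ball. -/
theorem norm_gradient_le_of_lipschitz_closedBall {f : E → ℝ} {x : E} {R L : ℝ} (hR : 0 < R)
    (hL : 0 ≤ L) (hf : DifferentiableAt ℝ f x) (hx : x ∈ Metric.closedBall (0 : E) R)
    (hlip : ∀ y ∈ Metric.closedBall (0 : E) R, ∀ z ∈ Metric.closedBall (0 : E) R,
      |f y - f z| ≤ L * ‖y - z‖) : ‖gradient f x‖ ≤ L := by
  set g := gradient f x with hg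
  have key : ∀ v : E, x + v ∈ Metric.closedBall (0 : E) R → |inner ℝ g v| ≤ L * ‖v‖ := by
    intro v hv
    refine le_of_tendsto (tendsto_slope_inner_gradient hf v).abs ?_
    have hmem : Set.Ioc (0 : ℝ) 1 ∈ nhdsWithin (0 : ℝ) (Set.Ioi 0) :=
      Ioc_mem_nhdsGT one_pos
    filter_upwards [hmem] with t ht
    have hconv := (convex_closedBall (0 : E) R).add_smul_mem hx hv ⟨ht.1.le, ht.2⟩
    have := hlip _ hconv _ hx
    rw [add_sub_cancel_left, norm_smul, Real.norm_of_nonneg ht.1.le] at this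
    rw [abs_mul, abs_inv, abs_of_pos ht.1, inv_mul_le_iff₀ ht.1]
    linarith
  -- If ⟨x, k⟩ > 0, then -k points into the ball. The step t = ⟨x, k⟩/‖k‖² minimizes ‖x - t k‖, so x
  -- - t k stays inside, even for x on the boundary sphere.
  have hcone : ∀ k : E, 0 < inner ℝ x k → |inner ℝ g k| ≤ L * ‖k‖ := by
    intro k hk
    have hk0 : k ≠ 0 := by rintro rfl; simp at hk
    have hkn : 0 < ‖k‖ := norm_pos_iff.2 hk0
    set t := inner ℝ x k / ‖k‖ ^ 2 with ht
    have ht0 : 0 < t := by positivity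
    have h := key (-(t • k)) (by
      rw [mem_closedBall_zero_iff] at hx ⊢
      refine le_trans ?_ hx
      rw [← sub_eq_add_neg]
      rw [← sq_le_sq₀ (norm_nonneg _) (norm_nonneg _), norm_sub_sq_real, inner_smul_right,
        norm_smul, Real.norm_of_nonneg ht0.le]
      have h1 : t * ‖k‖ ^ 2 = inner ℝ x k := div_mul_cancel₀ _ (by positivity)
      nlinarith [mul_pos ht0 hk])
    rw [inner_neg_right, abs_neg, norm_neg, inner_smul_right, abs_mul, norm_smul,
      Real.norm_eq_abs, abs_of_pos ht0] at h
    exact le_of_mul_le_mul_left (by linarith) ht0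
  have hgg : inner ℝ g g = ‖g‖ ^ 2 := real_inner_self_eq_norm_sq g
  have conclude : ‖g‖ ^ 2 ≤ L * ‖g‖ → ‖g‖ ≤ L := by
    intro h
    by_contra hc
    push Not at hc
    nlinarith
  apply conclude
  rcases eq_or_ne x 0 with rfl | hx0
  · rcases eq_or_ne g 0 with h0 | h0
    · simp [h0]
    have hgn : 0 < ‖g‖ := norm_pos_iff.2 h0
    have h := key ((R / ‖g‖) • g) (by
      simp [norm_smul, abs_of_pos hR, hgn.ne'])
    have ht : 0 < R / ‖g‖ := by positivity
    rw [inner_smul_right, abs_mul, norm_smul, Real.norm_eq_abs, abs_of_pos ht, hgg,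
      abs_of_nonneg (sq_nonneg _)] at h
    exact le_of_mul_le_mul_left (by linarith) ht
  -- Either -g or g lies in the closed half-space ⟨x, ·⟩ ≥ 0. In the second case ⟨x, g⟩ may vanish,
  -- so g is tilted by a small multiple η of x. The choice of η makes the error at most δ, and δ is
  -- arbitrary.
  · rcases lt_or_ge (inner ℝ x g) 0 with hneg | hpos
    · have h := hcone (-g) (by rw [inner_neg_right]; linarith)
      rw [inner_neg_right, abs_neg, norm_neg, hgg, abs_of_nonneg (sq_nonneg _)] at h
      exact h
    · have hxn : 0 < ‖x‖ := norm_pos_iff.2 hx0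
      refine le_of_forall_pos_le_add fun δ hδ => ?_
      have hη : 0 < δ / (L * ‖x‖ + 1) := by positivity
      set η := δ / (L * ‖x‖ + 1) with hηd
      have h := hcone (g + η • x) (by
        rw [inner_add_right, inner_smul_right, real_inner_self_eq_norm_sq]; positivity)
      have h1 : inner ℝ g (g + η • x) = ‖g‖ ^ 2 + η * inner ℝ x g := by
        rw [inner_add_right, inner_smul_right, hgg, real_inner_comm]
      have h2 : ‖g + η • x‖ ≤ ‖g‖ + η * ‖x‖ := by
        refine (norm_add_le _ _).trans ?_
        rw [norm_smul, Real.norm_of_nonneg hη.le]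
      have h3 : η * (L * ‖x‖ + 1) = δ := by rw [hηd]; field_simp
      have h4 := le_abs_self (inner ℝ g (g + η • x))
      have h5 := mul_le_mul_of_nonneg_left h2 hL
      have h6 : 0 ≤ η * inner ℝ x g := by positivity
      nlinarith

end Gradient

/-- Each coordinate of the gradient is a pointwise limit, along steps 1/(n+1), of difference
quotients that are jointly measurable in (θ, ξ). -/
theorem measurable_gradient_uncurry {d s : ℕ} {ℓ : Euc d → Euc s → ℝ}
    (hm : Measurable (Function.uncurry ℓ)) (hd : ∀ ξ, Differentiable ℝ (fun θ => ℓ θ ξ)) :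
    Measurable (fun p : Euc d × Euc s => gradient (fun θ => ℓ θ p.2) p.1) := by
  have hcoord : ∀ v : Euc d, Measurable
      (fun p : Euc d × Euc s => inner ℝ (gradient (fun θ => ℓ θ p.2) p.1) v) := by
    intro v
    have hlim : Filter.Tendsto (fun n : ℕ => 1 / ((n : ℝ) + 1)) Filter.atTop
        (nhdsWithin 0 (Set.Ioi 0)) :=
      tendsto_nhdsWithin_iff.2 ⟨tendsto_one_div_add_atTop_nhds_zero_nat,
        Filter.Eventually.of_forall fun n => by simp only [Set.mem_Ioi]; positivity⟩
    refine measurable_of_tendsto_metrizable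
      (f := fun (n : ℕ) (p : Euc d × Euc s) =>
        (1 / ((n : ℝ) + 1))⁻¹ * (ℓ (p.1 + (1 / ((n : ℝ) + 1)) • v) p.2 - ℓ p.1 p.2)) ?_ ?_
    · intro n
      have h1 : Measurable (fun p : Euc d × Euc s =>
          Function.uncurry ℓ (p.1 + (1 / ((n : ℝ) + 1)) • v, p.2)) :=
        hm.comp ((measurable_fst.add_const _).prodMk measurable_snd)
      exact (h1.sub hm).const_mul _
    · rw [tendsto_pi_nhds]
      intro p
      exact (tendsto_slope_inner_gradient (hd p.2 p.1) v).comp hlim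
  have hrepr : (fun p : Euc d × Euc s => gradient (fun θ => ℓ θ p.2) p.1) = fun p =>
      ∑ i, (inner ℝ (gradient (fun θ => ℓ θ p.2) p.1) (EuclideanSpace.basisFun (Fin d) ℝ i)) •
        (EuclideanSpace.basisFun (Fin d) ℝ i) := by
    funext p
    conv_lhs => rw [← (EuclideanSpace.basisFun (Fin d) ℝ).sum_repr'
      (gradient (fun θ => ℓ θ p.2) p.1)]
    exact Finset.sum_congr rfl fun i _ => by rw [real_inner_comm]
  rw [hrepr]
  exact Finset.measurable_sum _ fun i _ => (hcoord _).smul_const _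

/-! ### Projection onto the ball. -/

section Projection

variable {E : Type*} [NormedAddCommGroup E] [InnerProductSpace ℝ E]

open Classical in
/-- The nearest-point projection onto the closed ball of radius `R` centred at the origin. -/
noncomputable def ballProj (R : ℝ) (x : E) : E :=
  if ‖x‖ ≤ R then x else (R / ‖x‖) • x

theorem ballProj_mem {R : ℝ} (hR : 0 ≤ R) (x : E) :
    ballProj R x ∈ Metric.closedBall (0 : E) R := by
  rw [mem_closedBall_zero_iff, ballProj]
  split_ifs with h
  · exact h
  · have : 0 < ‖x‖ := by linarith
    rw [norm_smul, Real.norm_of_nonneg (by positivity), div_mul_cancel₀ _ this.ne']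

theorem norm_ballProj_sub_le {R : ℝ} (hR : 0 ≤ R) (x : E) {y : E}
    (hy : y ∈ Metric.closedBall (0 : E) R) : ‖ballProj R x - y‖ ≤ ‖x - y‖ := by
  rw [mem_closedBall_zero_iff] at hy
  rw [ballProj]
  split_ifs with h
  · exact le_rfl
  push Not at h
  have hx : 0 < ‖x‖ := by linarith
  set r := R / ‖x‖ with hr
  have hr1 : r * ‖x‖ = R := div_mul_cancel₀ _ hx.ne'
  have hr0 : 0 ≤ r := by positivity
  have hr2 : r < 1 := (div_lt_one hx).2 h
  have hin : inner ℝ x y ≤ ‖x‖ * R := (real_inner_le_norm x y).trans (by gcongr)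
  rw [← sq_le_sq₀ (norm_nonneg _) (norm_nonneg _), norm_sub_sq_real, norm_sub_sq_real,
    norm_smul, Real.norm_of_nonneg hr0, hr1, inner_smul_left]
  simp only [conj_trivial]
  -- By Cauchy–Schwarz, ‖x - y‖² - ‖r x - y‖² ≥ ‖x‖² - R² - 2(‖x‖ - R)R = (‖x‖ - R)².
  nlinarith

theorem measurable_ballProj {R : ℝ} [MeasurableSpace E] [BorelSpace E]
    [SecondCountableTopology E] : Measurable (ballProj R : E → E) := by
  refine Measurable.ite (measurableSet_le measurable_norm measurable_const) measurable_id ?_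
  exact (measurable_const.div measurable_norm).smul measurable_id

end Projection

/-! ### Regularity of the risk on the ball. -/

namespace StronglyConvexLoss

variable {d s : ℕ} {μ L : ℝ} {D : Measure (Euc s)} {ℓ : Euc d → Euc s → ℝ}

theorem norm_gradient_le (h : StronglyConvexLoss μ L D ℓ) (hμ : 0 < μ) (hL : 0 < L) (ξ : Euc s)
    {θ : Euc d} (hθ : θ ∈ Metric.closedBall (0 : Euc d) (L / (2 * μ))) :
    ‖gradient (fun η => ℓ η ξ) θ‖ ≤ L :=
  norm_gradient_le_of_lipschitz_closedBall (by positivity) hL.le (h.differentiable ξ θ) hθ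
    (h.lipschitz ξ)

theorem measurable_gradient (h : StronglyConvexLoss μ L D ℓ) :
    Measurable (fun p : Euc d × Euc s => gradient (fun θ => ℓ θ p.2) p.1) :=
  measurable_gradient_uncurry h.measurable h.differentiable

theorem integrable_gradient [IsProbabilityMeasure D] (h : StronglyConvexLoss μ L D ℓ) (hμ : 0 < μ)
    (hL : 0 < L) {θ : Euc d} (hθ : θ ∈ Metric.closedBall (0 : Euc d) (L / (2 * μ))) :
    Integrable (fun ξ => gradient (fun η => ℓ η ξ) θ) D :=
  Integrable.of_bound (h.measurable_gradient.comp measurable_prodMk_left).aestronglyMeasurable L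
    (Filter.Eventually.of_forall fun ξ => h.norm_gradient_le hμ hL ξ hθ)

/-- The mean gradient is a strong subgradient of the risk on the ball. -/
theorem risk_add_inner_le [IsProbabilityMeasure D] (h : StronglyConvexLoss μ L D ℓ) (hμ : 0 < μ)
    (hL : 0 < L) {θ θ' : Euc d} (hθ : θ ∈ Metric.closedBall (0 : Euc d) (L / (2 * μ)))
    (hθ' : θ' ∈ Metric.closedBall (0 : Euc d) (L / (2 * μ))) :
    risk D ℓ θ + inner ℝ (∫ ξ, gradient (fun η => ℓ η ξ) θ ∂D) (θ' - θ)
      + μ / 2 * ‖θ' - θ‖ ^ 2 ≤ risk D ℓ θ' := by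
  have hint := h.integrable_gradient hμ hL hθ
  have hin : Integrable (fun ξ => inner ℝ (gradient (fun η => ℓ η ξ) θ) (θ' - θ)) D :=
    hint.inner_const _
  have hsum : Integrable
      (fun ξ => ℓ θ ξ + inner ℝ (gradient (fun η => ℓ η ξ) θ) (θ' - θ)) D :=
    (h.integrable θ).add hin
  have h1 : inner ℝ (∫ ξ, gradient (fun η => ℓ η ξ) θ ∂D) (θ' - θ)
      = ∫ ξ, inner ℝ (gradient (fun η => ℓ η ξ) θ) (θ' - θ) ∂D := by
    rw [real_inner_comm, ← integral_inner hint]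
    simp only [real_inner_comm]
  have h2 : risk D ℓ θ + inner ℝ (∫ ξ, gradient (fun η => ℓ η ξ) θ ∂D) (θ' - θ)
      + μ / 2 * ‖θ' - θ‖ ^ 2 = ∫ ξ, (ℓ θ ξ + inner ℝ (gradient (fun η => ℓ η ξ) θ) (θ' - θ)
        + μ / 2 * ‖θ' - θ‖ ^ 2) ∂D := by
    rw [integral_add hsum (integrable_const _),
      integral_add (h.integrable θ) hin, h1]
    simp [risk]
  rw [h2]
  exact integral_mono (hsum.add (integrable_const _)) (h.integrable θ')
    fun ξ => h.stronglyConvex ξ θ hθ θ' hθ'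

theorem iInf_risk_eq {θr : Euc d} (hmin : ∀ θ, risk D ℓ θr ≤ risk D ℓ θ) :
    ⨅ θ, risk D ℓ θ = risk D ℓ θr :=
  le_antisymm (ciInf_le ⟨_, Set.forall_mem_range.2 hmin⟩ θr) (le_ciInf hmin)

/-- Jensen's inequality for the risk on the ball. -/
theorem risk_sum_le [IsProbabilityMeasure D] (h : StronglyConvexLoss μ L D ℓ) (hμ : 0 < μ)
    (hL : 0 < L) {ι : Type*} (I : Finset ι) (w : ι → ℝ) (x : ι → Euc d)
    (hw : ∀ i ∈ I, 0 ≤ w i) (hw1 : ∑ i ∈ I, w i = 1)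
    (hx : ∀ i ∈ I, x i ∈ Metric.closedBall (0 : Euc d) (L / (2 * μ))) :
    risk D ℓ (∑ i ∈ I, w i • x i) ≤ ∑ i ∈ I, w i * risk D ℓ (x i) := by
  have hmem := (convex_closedBall (0 : Euc d) (L / (2 * μ))).sum_mem hw hw1 hx
  set y := ∑ i ∈ I, w i • x i with hy
  set G := ∫ ξ, gradient (fun η => ℓ η ξ) y ∂D
  -- Compare with the tangent at the barycentre y: its linear terms cancel in the weighted sum.
  have h1 : ∀ i ∈ I, w i * (risk D ℓ y + inner ℝ G (x i - y)) ≤ w i * risk D ℓ (x i) := by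
    intro i hi
    refine mul_le_mul_of_nonneg_left ?_ (hw i hi)
    have := h.risk_add_inner_le hμ hL hmem (hx i hi)
    have h2 : 0 ≤ μ / 2 * ‖x i - y‖ ^ 2 := by positivity
    linarith
  refine le_trans (le_of_eq ?_) (Finset.sum_le_sum h1)
  have h3 : ∑ i ∈ I, w i * inner ℝ G (x i - y) = 0 := by
    have : ∑ i ∈ I, w i * inner ℝ G (x i - y) = inner ℝ G (∑ i ∈ I, w i • (x i - y)) := by
      rw [inner_sum]
      simp [inner_smul_right]
    rw [this]
    simp only [smul_sub, Finset.sum_sub_distrib, ← Finset.sum_smul, hw1, one_smul, ← hy, sub_self,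
      inner_zero_right]
  simp only [mul_add, Finset.sum_add_distrib, h3, ← Finset.sum_mul, hw1, one_mul, add_zero]

theorem abs_risk_sub_le [IsProbabilityMeasure D] (h : StronglyConvexLoss μ L D ℓ)
    {θ θ' : Euc d} (hθ : θ ∈ Metric.closedBall (0 : Euc d) (L / (2 * μ)))
    (hθ' : θ' ∈ Metric.closedBall (0 : Euc d) (L / (2 * μ))) :
    |risk D ℓ θ - risk D ℓ θ'| ≤ L * ‖θ - θ'‖ := by
  rw [risk, risk, ← integral_sub (h.integrable _) (h.integrable _)]
  have := norm_integral_le_of_norm_le_const (μ := D) (f := fun ξ => ℓ θ ξ - ℓ θ' ξ)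
    (C := L * ‖θ - θ'‖) (Filter.Eventually.of_forall fun ξ => h.lipschitz ξ θ hθ θ' hθ')
  simpa using this

theorem measurable_risk [IsProbabilityMeasure D] (h : StronglyConvexLoss μ L D ℓ) :
    Measurable (risk D ℓ) :=
  (StronglyMeasurable.integral_prod_right (ν := D) h.measurable.stronglyMeasurable).measurable

end StronglyConvexLoss

/-! ### Independence of the past and the current sample. -/

section Independence

open ProbabilityTheory

/-- Fubini for the joint law, which is a product by independence. It plays the role of conditioning
on the past: Y is averaged out with X frozen. -/
theorem integral_comp_prod_of_indepFun {Ω α β : Type*} [MeasurableSpace Ω] [MeasurableSpace α]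
    [MeasurableSpace β] {P : Measure Ω} [IsProbabilityMeasure P] {X : Ω → α} {Y : Ω → β}
    (h : IndepFun X Y P) (hX : Measurable X) (hY : Measurable Y) {G : α × β → ℝ}
    (hG : Measurable G) (hint : Integrable (fun ω => G (X ω, Y ω)) P) :
    Integrable (fun ω => ∫ y, G (X ω, y) ∂(P.map Y)) P ∧
      ∫ ω, G (X ω, Y ω) ∂P = ∫ ω, ∫ y, G (X ω, y) ∂(P.map Y) ∂P := by
  have : IsProbabilityMeasure (P.map X) := Measure.isProbabilityMeasure_map hX.aemeasurable
  have : IsProbabilityMeasure (P.map Y) := Measure.isProbabilityMeasure_map hY.aemeasurable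
  have hmap := (indepFun_iff_map_prod_eq_prod_map_map hX.aemeasurable hY.aemeasurable).1 h
  have hXY : Measurable fun ω => (X ω, Y ω) := hX.prodMk hY
  have hint' : Integrable G ((P.map X).prod (P.map Y)) := by
    rw [← hmap]
    exact (integrable_map_measure hG.aestronglyMeasurable hXY.aemeasurable).2 hint
  have hin := hint'.integral_prod_left
  refine ⟨(integrable_map_measure hin.aestronglyMeasurable hX.aemeasurable).1 hin, ?_⟩
  rw [← integral_map (f := G) hXY.aemeasurable hG.aestronglyMeasurable, hmap,
    integral_prod _ hint', integral_map hX.aemeasurable hin.aestronglyMeasurable]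

/-- A function of the first `t` coordinates of an independent sequence is independent of the
coordinate `t`. -/
theorem indepFun_infinitePi_of_prefix {Ω β : Type*} [MeasurableSpace Ω] [MeasurableSpace β]
    (D : Measure Ω) [IsProbabilityMeasure D] {t : ℕ} {X : (ℕ → Ω) → β} (hX : Measurable X)
    (hdep : ∀ ξ ξ' : ℕ → Ω, (∀ i < t, ξ i = ξ' i) → X ξ = X ξ') :
    IndepFun X (fun ξ => ξ t) (Measure.infinitePi fun _ : ℕ => D) := by
  classical
  have : Nonempty Ω := D.nonempty_of_neZero
  obtain ⟨o⟩ := this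
  have h0 : iIndepFun (fun (i : ℕ) (ξ : ℕ → Ω) => ξ i) (Measure.infinitePi fun _ : ℕ => D) :=
    iIndepFun_infinitePi (X := fun _ x => x) fun _ => measurable_id
  have h1 := h0.indepFun_finset (Finset.range t) {t} (by simp) fun i => measurable_pi_apply i
  -- Padding with a dummy point `o` factors X through its first t coordinates, so independence of
  -- finite coordinate blocks applies.
  let ext : (Finset.range t → Ω) → ℕ → Ω := fun z i =>
    if hi : i ∈ Finset.range t then z ⟨i, hi⟩ else o
  have hext : Measurable ext := by
    refine measurable_pi_lambda _ fun i => ?_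
    by_cases hi : i ∈ Finset.range t
    · simp only [ext, hi, dite_true]
      exact measurable_pi_apply _
    · simp only [ext, hi, dite_false]
      exact measurable_const
  have hlast : Measurable fun z : ({t} : Finset ℕ) → Ω => z ⟨t, by simp⟩ := measurable_pi_apply _
  have h2 := h1.comp (hX.comp hext) hlast
  have h3 : (X ∘ ext) ∘ (fun (ξ : ℕ → Ω) (i : Finset.range t) => ξ i) = X := by
    funext ξ
    refine hdep _ _ fun i hi => ?_
    simp [ext, hi]
  rw [h3] at h2
  exact h2

end Independence

/-! ### Projected stochastic gradient method and its averaged output. -/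

/-- Iterates of the projected stochastic gradient method on the ball of radius `R` with step
sizes `γ`. -/
noncomputable def projSGD {d s : ℕ} (R : ℝ) (γ : ℕ → ℝ) (ℓ : Euc d → Euc s → ℝ) (ξ : ℕ → Euc s) :
    ℕ → Euc d
  | 0 => 0
  | t + 1 => ballProj R (projSGD R γ ℓ ξ t -
      γ t • gradient (fun θ => ℓ θ (ξ t)) (projSGD R γ ℓ ξ t))

section Iterates

variable {d s : ℕ} {R : ℝ} {γ : ℕ → ℝ} {ℓ : Euc d → Euc s → ℝ}

theorem projSGD_mem (hR : 0 ≤ R) (ξ : ℕ → Euc s) :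
    ∀ t, projSGD R γ ℓ ξ t ∈ Metric.closedBall (0 : Euc d) R
  | 0 => by simpa [projSGD] using hR
  | _ + 1 => ballProj_mem hR _

theorem projSGD_congr {ξ ξ' : ℕ → Euc s} :
    ∀ {t : ℕ}, (∀ i < t, ξ i = ξ' i) → projSGD R γ ℓ ξ t = projSGD R γ ℓ ξ' t
  | 0, _ => rfl
  | t + 1, h => by
      have := projSGD_congr (t := t) fun i hi => h i (by omega)
      simp only [projSGD, this, h t (by omega)]

theorem measurable_projSGD
    (hg : Measurable (fun p : Euc d × Euc s => gradient (fun θ => ℓ θ p.2) p.1)) :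
    ∀ t, Measurable fun ξ : ℕ → Euc s => projSGD R γ ℓ ξ t
  | 0 => measurable_const
  | t + 1 => by
      have ih := measurable_projSGD hg t
      exact measurable_ballProj.comp
        (ih.sub ((hg.comp (ih.prodMk (measurable_pi_apply t))).const_smul (γ t)))

end Iterates

/-- The projected stochastic gradient method that, after `N` steps, outputs the average of its
iterates with weights `w`. -/
noncomputable def averagedSGD (d : ℕ) (R : ℝ) (γ w : ℕ → ℝ) (N : ℕ) : FirstOrderAlgorithm d where
  Mem := ℕ × Euc d
  initMem := (0, 0)
  Seed := Unit
  seedLaw := Measure.dirac ()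
  update p :=
    -- The memory is a step counter and a running weighted sum of θ_0, …, θ_{N-1}. One extra step,
    -- at counter N, moves the model to that sum. From time N + 1 on the model is frozen, as the
    -- retraining time asks for a bound at all later times.
    (if p.2.2.1.1 < N then ballProj R (p.1 - γ p.2.2.1.1 • p.2.1) else p.2.2.1.2,
      (p.2.2.1.1 + 1, if p.2.2.1.1 < N then p.2.2.1.2 + w p.2.2.1.1 • p.1 else p.2.2.1.2))
  measurable_update := by
    have h1 : Measurable fun p : Euc d × Euc d × (ℕ × Euc d) × Unit => p.2.2.1.1 := by fun_prop
    have h2 : Measurable fun p : Euc d × Euc d × (ℕ × Euc d) × Unit => p.2.2.1.2 := by fun_prop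
    have hlt : MeasurableSet {p : Euc d × Euc d × (ℕ × Euc d) × Unit | p.2.2.1.1 < N} :=
      measurableSet_lt h1 measurable_const
    have hγ : Measurable fun p : Euc d × Euc d × (ℕ × Euc d) × Unit => γ p.2.2.1.1 :=
      (measurable_of_countable γ).comp h1
    have hw : Measurable fun p : Euc d × Euc d × (ℕ × Euc d) × Unit => w p.2.2.1.1 :=
      (measurable_of_countable w).comp h1
    refine Measurable.prodMk (Measurable.ite hlt ?_ h2) (Measurable.prodMk (by fun_prop)
      (Measurable.ite hlt ?_ h2))
    · exact measurable_ballProj.comp (measurable_fst.sub (hγ.smul (by fun_prop)))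
    · exact h2.add (hw.smul measurable_fst)

theorem FirstOrderAlgorithm.state_succ {d s : ℕ} (A : FirstOrderAlgorithm d)
    (ℓ : Euc d → Euc s → ℝ) (ξ : ℕ → Euc s) (ω : A.Seed) (t : ℕ) :
    A.state ℓ ξ ω (t + 1) = A.update ((A.state ℓ ξ ω t).1,
      gradient (fun θ => ℓ θ (ξ t)) (A.state ℓ ξ ω t).1, (A.state ℓ ξ ω t).2, ω) :=
  rfl

section State

variable {d s : ℕ} {R : ℝ} {γ w : ℕ → ℝ} {N : ℕ} {ℓ : Euc d → Euc s → ℝ} {ξ : ℕ → Euc s}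

theorem averagedSGD_state_of_le (u : (averagedSGD d R γ w N).Seed) :
    ∀ {t : ℕ}, t ≤ N → (averagedSGD d R γ w N).state ℓ ξ u t =
      (projSGD R γ ℓ ξ t, (t, ∑ i ∈ Finset.range t, w i • projSGD R γ ℓ ξ i))
  | 0, _ => rfl
  | t + 1, h => by
      have ih := averagedSGD_state_of_le u (t := t) (by omega)
      have ht : t < N := by omega
      rw [FirstOrderAlgorithm.state_succ, ih]
      simp [averagedSGD, ht, projSGD, Finset.sum_range_succ]

theorem averagedSGD_state_add (u : (averagedSGD d R γ w N).Seed) : ∀ k : ℕ,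
    (averagedSGD d R γ w N).state ℓ ξ u (N + 1 + k) =
      (∑ i ∈ Finset.range N, w i • projSGD R γ ℓ ξ i,
        (N + 1 + k, ∑ i ∈ Finset.range N, w i • projSGD R γ ℓ ξ i))
  | 0 => by
      rw [Nat.add_zero, FirstOrderAlgorithm.state_succ, averagedSGD_state_of_le u le_rfl]
      simp [averagedSGD]
  | k + 1 => by
      rw [← Nat.add_assoc, FirstOrderAlgorithm.state_succ, averagedSGD_state_add u k]
      have : ¬ (N + 1 + k < N) := by omega
      simp [averagedSGD, this]

end State

/-- Summation of the one-step recursion of the stochastic gradient method with steps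
`2 / (μ (t + 2))`. -/
theorem sum_weighted_le_of_recursion {μ B : ℝ} (hμ : 0 < μ) {a D : ℕ → ℝ} (hD : ∀ t, 0 ≤ D t)
    (hrec : ∀ t : ℕ, D (t + 1) ≤ D t - 2 * (2 / (μ * (t + 2))) * (a t + μ / 2 * D t)
      + (2 / (μ * (t + 2))) ^ 2 * B) (hB : 0 ≤ B) (n : ℕ) :
    ∑ t ∈ Finset.range n, ((t : ℝ) + 1) * a t ≤ n * B / μ := by
  -- Potential-function argument. With γ = 2/(μ(n+2)) the contraction factor is 1 - μγ = n/(n+2), so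
  -- multiplying the recursion by μ(n+1)(n+2)/4 makes the D terms telescope and gives a_n the weight
  -- n+1. The coefficient of D 0 is zero, so the initial distance does not enter.
  suffices h : ∑ t ∈ Finset.range n, ((t : ℝ) + 1) * a t + μ * n * (n + 1) / 4 * D n
      ≤ n * B / μ by
    have : 0 ≤ μ * n * (n + 1) / 4 * D n := mul_nonneg (by positivity) (hD n)
    linarith
  induction n with
  | zero => simp
  | succ n ih =>
    rw [Finset.sum_range_succ]
    have h1 := hrec n
    have hc : 0 ≤ μ * (n + 1) * (n + 2) / 4 := by positivity
    have h2 := mul_le_mul_of_nonneg_left h1 hc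
    have h3 : μ * ((n : ℝ) + 1) * (n + 2) / 4 * (D n - 2 * (2 / (μ * (n + 2))) * (a n + μ / 2 * D n)
        + (2 / (μ * (n + 2))) ^ 2 * B) = μ * n * (n + 1) / 4 * D n - ((n : ℝ) + 1) * a n
          + (n + 1) / (n + 2) * (B / μ) := by
      field_simp
      ring
    have h4 : ((n : ℝ) + 1) / (n + 2) * (B / μ) ≤ B / μ := by
      have : ((n : ℝ) + 1) / (n + 2) ≤ 1 := by
        rw [div_le_one (by positivity)]; linarith
      exact mul_le_of_le_one_left (by positivity) this
    have h5 : ((n : ℝ) + 1) * B / μ = n * B / μ + B / μ := by ring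
    push_cast
    rw [h5]
    have h6 : μ * ((n : ℝ) + 1) * (n + 1 + 1) / 4 = μ * (n + 1) * (n + 2) / 4 := by ring
    rw [h6]
    linarith

/-! ### Convergence rate and the upper bound. -/

section Convergence

variable {d s : ℕ} {μ L : ℝ} {D : Measure (Euc s)} [IsProbabilityMeasure D]
  {ℓ : Euc d → Euc s → ℝ}

theorem integrable_risk_projSGD (h : StronglyConvexLoss μ L D ℓ) (hμ : 0 < μ) (hL : 0 < L)
    (γ : ℕ → ℝ) {θr : Euc d} (hθr : θr ∈ Metric.closedBall (0 : Euc d) (L / (2 * μ))) (t : ℕ) :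
    Integrable (fun ξ => risk D ℓ (projSGD (L / (2 * μ)) γ ℓ ξ t) - risk D ℓ θr)
      (Measure.infinitePi fun _ : ℕ => D) := by
  have hR : 0 ≤ L / (2 * μ) := by positivity
  refine Integrable.of_bound (C := L * (L / (2 * μ) + L / (2 * μ)))
    ((h.measurable_risk.comp (measurable_projSGD h.measurable_gradient t)).sub
      measurable_const).aestronglyMeasurable (Filter.Eventually.of_forall fun ξ => ?_)
  have hm := projSGD_mem (γ := γ) (ℓ := ℓ) hR ξ t
  refine (h.abs_risk_sub_le hm hθr).trans (mul_le_mul_of_nonneg_left ?_ hL.le)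
  exact (norm_sub_le _ _).trans
    (add_le_add (mem_closedBall_zero_iff.1 hm) (mem_closedBall_zero_iff.1 hθr))

theorem integrable_dist_projSGD (h : StronglyConvexLoss μ L D ℓ) (hμ : 0 < μ) (hL : 0 < L)
    (γ : ℕ → ℝ) {θr : Euc d} (hθr : θr ∈ Metric.closedBall (0 : Euc d) (L / (2 * μ))) (t : ℕ) :
    Integrable (fun ξ => ‖projSGD (L / (2 * μ)) γ ℓ ξ t - θr‖ ^ 2)
      (Measure.infinitePi fun _ : ℕ => D) := by
  have hR : 0 ≤ L / (2 * μ) := by positivity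
  refine Integrable.of_bound (C := (L / (2 * μ) + L / (2 * μ)) ^ 2)
    (((measurable_projSGD h.measurable_gradient t).sub
      measurable_const).norm.pow_const 2).aestronglyMeasurable
    (Filter.Eventually.of_forall fun ξ => ?_)
  have hm := projSGD_mem (γ := γ) (ℓ := ℓ) hR ξ t
  rw [Real.norm_of_nonneg (by positivity)]
  exact pow_le_pow_left₀ (norm_nonneg _) ((norm_sub_le _ _).trans
    (add_le_add (mem_closedBall_zero_iff.1 hm) (mem_closedBall_zero_iff.1 hθr))) 2

/-- The one-step recursion of the projected stochastic gradient method. -/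
theorem projSGD_recursion (h : StronglyConvexLoss μ L D ℓ) (hμ : 0 < μ) (hL : 0 < L)
    {γ : ℕ → ℝ} (hγ : ∀ t, 0 ≤ γ t) {θr : Euc d}
    (hθr : θr ∈ Metric.closedBall (0 : Euc d) (L / (2 * μ))) (t : ℕ) :
    ∫ ξ, ‖projSGD (L / (2 * μ)) γ ℓ ξ (t + 1) - θr‖ ^ 2 ∂(Measure.infinitePi fun _ : ℕ => D) ≤
      ∫ ξ, ‖projSGD (L / (2 * μ)) γ ℓ ξ t - θr‖ ^ 2 ∂(Measure.infinitePi fun _ : ℕ => D)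
      - 2 * γ t * (∫ ξ, (risk D ℓ (projSGD (L / (2 * μ)) γ ℓ ξ t) - risk D ℓ θr)
            ∂(Measure.infinitePi fun _ : ℕ => D)
          + μ / 2 * ∫ ξ, ‖projSGD (L / (2 * μ)) γ ℓ ξ t - θr‖ ^ 2
            ∂(Measure.infinitePi fun _ : ℕ => D))
      + γ t ^ 2 * L ^ 2 := by
  set P := Measure.infinitePi fun _ : ℕ => D with hP
  have hR : 0 ≤ L / (2 * μ) := by positivity
  set X := fun (ξ : ℕ → Euc s) => projSGD (L / (2 * μ)) γ ℓ ξ t with hX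
  have hXm : Measurable X := measurable_projSGD h.measurable_gradient t
  have hXb : ∀ ξ, X ξ ∈ Metric.closedBall (0 : Euc d) (L / (2 * μ)) := fun ξ => projSGD_mem hR ξ t
  have hind : ProbabilityTheory.IndepFun X (fun ξ => ξ t) P :=
    indepFun_infinitePi_of_prefix D hXm fun ξ ξ' hξ => projSGD_congr hξ
  set G : Euc d × Euc s → ℝ := fun p =>
    inner ℝ (gradient (fun θ => ℓ θ p.2) p.1) (p.1 - θr) with hG
  have hGm : Measurable G :=
    h.measurable_gradient.inner (measurable_fst.sub measurable_const)
  have hGi : Integrable (fun ξ : ℕ → Euc s => G (X ξ, ξ t)) P := by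
    refine Integrable.of_bound (C := L * (L / (2 * μ) + L / (2 * μ)))
      (hGm.comp (hXm.prodMk (measurable_pi_apply t))).aestronglyMeasurable
      (Filter.Eventually.of_forall fun ξ => ?_)
    refine (norm_inner_le_norm _ _).trans ?_
    refine mul_le_mul (h.norm_gradient_le hμ hL _ (hXb ξ)) ?_ (norm_nonneg _) hL.le
    exact (norm_sub_le _ _).trans
      (add_le_add (mem_closedBall_zero_iff.1 (hXb ξ)) (mem_closedBall_zero_iff.1 hθr))
  obtain ⟨hinner, heq⟩ := integral_comp_prod_of_indepFun hind hXm (measurable_pi_apply t) hGm hGi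
  rw [show P.map (fun ξ => ξ t) = D from Measure.infinitePi_map_eval (fun _ : ℕ => D) t]
    at hinner heq
  have hriskI := integrable_risk_projSGD h hμ hL γ hθr t
  have hdistI := integrable_dist_projSGD h hμ hL γ hθr t
  -- Independence replaces the stochastic gradient by the mean gradient at X, and the strong
  -- subgradient inequality is then applied between X and θr.
  have hlow : ∫ ξ, (risk D ℓ (X ξ) - risk D ℓ θr) ∂P + μ / 2 * ∫ ξ, ‖X ξ - θr‖ ^ 2 ∂P
      ≤ ∫ ξ, G (X ξ, ξ t) ∂P := by
    rw [heq, ← integral_const_mul, ← integral_add hriskI (hdistI.const_mul _)]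
    refine integral_mono (hriskI.add (hdistI.const_mul _)) hinner fun ξ => ?_
    have h1 := h.risk_add_inner_le hμ hL (hXb ξ) hθr
    have h2 : ∫ y, G (X ξ, y) ∂D
        = - inner ℝ (∫ y, gradient (fun η => ℓ η y) (X ξ) ∂D) (θr - X ξ) := by
      rw [← inner_neg_right, neg_sub, real_inner_comm,
        ← integral_inner (h.integrable_gradient hμ hL (hXb ξ))]
      simp only [hG, real_inner_comm]
    rw [norm_sub_rev] at h1
    simp only [h2]
    linarith
  -- Projecting does not increase the distance to θr, which lies in the ball. Expand the square and
  -- bound the gradient by L.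
  have hpt : ∀ ξ : ℕ → Euc s, ‖projSGD (L / (2 * μ)) γ ℓ ξ (t + 1) - θr‖ ^ 2 ≤
      ‖X ξ - θr‖ ^ 2 - 2 * γ t * G (X ξ, ξ t) + γ t ^ 2 * L ^ 2 := by
    intro ξ
    set g := gradient (fun θ => ℓ θ (ξ t)) (X ξ) with hg
    have h1 : ‖projSGD (L / (2 * μ)) γ ℓ ξ (t + 1) - θr‖ ≤ ‖(X ξ - θr) - γ t • g‖ := by
      refine (norm_ballProj_sub_le hR _ hθr).trans (le_of_eq ?_)
      congr 1
      simp only [hX, hg]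
      abel
    have h2 := pow_le_pow_left₀ (norm_nonneg _) h1 2
    rw [norm_sub_sq_real (X ξ - θr), inner_smul_right, norm_smul, Real.norm_of_nonneg (hγ t),
      mul_pow, real_inner_comm] at h2
    have h3 : ‖g‖ ^ 2 ≤ L ^ 2 :=
      pow_le_pow_left₀ (norm_nonneg _) (h.norm_gradient_le hμ hL _ (hXb ξ)) 2
    have h4 := mul_le_mul_of_nonneg_left h3 (sq_nonneg (γ t))
    have h5 : G (X ξ, ξ t) = inner ℝ g (X ξ - θr) := rfl
    rw [h5]
    linarith
  have hGγ := hGi.const_mul (2 * γ t)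
  have hdiff : Integrable (fun ξ => ‖X ξ - θr‖ ^ 2 - 2 * γ t * G (X ξ, ξ t)) P := hdistI.sub hGγ
  have hmono := integral_mono (integrable_dist_projSGD h hμ hL γ hθr (t + 1))
    (hdiff.add (integrable_const (γ t ^ 2 * L ^ 2))) hpt
  simp only [Pi.add_apply] at hmono
  rw [integral_add hdiff (integrable_const _), integral_sub hdistI hGγ, integral_const_mul,
    integral_const] at hmono
  simp only [probReal_univ, one_smul] at hmono
  have hγ2 : 0 ≤ 2 * γ t := by linarith [hγ t]
  have := mul_le_mul_of_nonneg_left hlow hγ2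
  linarith

theorem averagedSGD_expectedExcess_le (h : StronglyConvexLoss μ L D ℓ) (hμ : 0 < μ) (hL : 0 < L)
    {N : ℕ} (hN : 0 < N) {T : ℕ} (hT : N + 1 ≤ T) :
    (averagedSGD d (L / (2 * μ)) (fun t => 2 / (μ * (t + 2)))
      (fun t => 2 * (t + 1) / (N * (N + 1))) N).expectedExcess D ℓ T
      ≤ ENNReal.ofReal (2 * L ^ 2 / (μ * (N + 1))) := by
  obtain ⟨k, rfl⟩ := Nat.exists_eq_add_of_le hT
  obtain ⟨θr, hθr, hmin⟩ := h.exists_minimizer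
  set γ : ℕ → ℝ := fun t => 2 / (μ * (t + 2)) with hγ
  set w : ℕ → ℝ := fun t => 2 * (t + 1) / (N * (N + 1)) with hw
  set P := Measure.infinitePi fun _ : ℕ => D with hP
  have hR : 0 ≤ L / (2 * μ) := by positivity
  have hN' : (0 : ℝ) < N := by exact_mod_cast hN
  have hw0 : ∀ i, 0 ≤ w i := fun i => by simp only [hw]; positivity
  have hsum : ∀ n : ℕ, ∑ i ∈ Finset.range n, ((i : ℝ) + 1) = n * (n + 1) / 2 := by
    intro n
    induction n with
    | zero => simp
    | succ n ih => rw [Finset.sum_range_succ, ih]; push_cast; ring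
  have hw1 : ∑ i ∈ Finset.range N, w i = 1 := by
    simp only [hw]
    rw [← Finset.sum_div, ← Finset.mul_sum, hsum]
    field_simp
  set Φ : (ℕ → Euc s) → ℝ := fun ξ => ∑ i ∈ Finset.range N,
    w i * (risk D ℓ (projSGD (L / (2 * μ)) γ ℓ ξ i) - risk D ℓ θr) with hΦ
  have hΦi : Integrable Φ P := integrable_finsetSum _ fun i _ =>
    (integrable_risk_projSGD h hμ hL γ hθr i).const_mul _
  have hΦ0 : ∀ ξ, 0 ≤ Φ ξ := fun ξ => Finset.sum_nonneg fun i _ =>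
    mul_nonneg (hw0 i) (sub_nonneg.2 (hmin _))
  have hΦint : ∫ ξ, Φ ξ ∂P ≤ 2 * L ^ 2 / (μ * (N + 1)) := by
    simp only [hΦ]
    rw [integral_finsetSum _ fun i _ =>
      (integrable_risk_projSGD h hμ hL γ hθr i).const_mul _]
    simp only [integral_const_mul]
    have hrec := sum_weighted_le_of_recursion hμ (B := L ^ 2)
      (a := fun t => ∫ ξ, (risk D ℓ (projSGD (L / (2 * μ)) γ ℓ ξ t) - risk D ℓ θr) ∂P)
      (D := fun t => ∫ ξ, ‖projSGD (L / (2 * μ)) γ ℓ ξ t - θr‖ ^ 2 ∂P)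
      (fun t => integral_nonneg fun ξ => by positivity)
      (fun t => projSGD_recursion h hμ hL (γ := γ)
        (fun t => by simp only [hγ]; positivity) hθr t) (by positivity) N
    have hc : 0 ≤ 2 / ((N : ℝ) * (N + 1)) := by positivity
    have := mul_le_mul_of_nonneg_left hrec hc
    rw [Finset.mul_sum] at this
    refine le_trans (le_of_eq ?_) (this.trans (le_of_eq ?_))
    · refine Finset.sum_congr rfl fun i _ => ?_
      simp only [hw]
      ring
    · field_simp
  have hle : ∀ x : (ℕ → Euc s) × (averagedSGD d (L / (2 * μ)) γ w N).Seed, ENNReal.ofReal (risk D ℓ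
      ((averagedSGD d (L / (2 * μ)) γ w N).state ℓ x.1 x.2 (N + 1 + k)).1 - ⨅ θ, risk D ℓ θ)
      ≤ ENNReal.ofReal (Φ x.1) := by
    intro x
    refine ENNReal.ofReal_le_ofReal ?_
    rw [averagedSGD_state_add, StronglyConvexLoss.iInf_risk_eq hmin]
    have hj := h.risk_sum_le hμ hL (Finset.range N) w
      (fun i => projSGD (L / (2 * μ)) γ ℓ x.1 i) (fun i _ => hw0 i) hw1
      fun i _ => projSGD_mem hR x.1 i
    simp only [hΦ, mul_sub, Finset.sum_sub_distrib, ← Finset.sum_mul, hw1, one_mul]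
    linarith
  have hcore : (averagedSGD d (L / (2 * μ)) γ w N).expectedExcess D ℓ (N + 1 + k)
      ≤ ∫⁻ ξ, ENNReal.ofReal (Φ ξ) ∂P := by
    rw [FirstOrderAlgorithm.expectedExcess]
    refine (lintegral_mono hle).trans ((lintegral_prod_le _).trans (le_of_eq ?_))
    simp only [lintegral_const, measure_univ, mul_one, hP]
  refine hcore.trans ?_
  rw [← ofReal_integral_eq_lintegral_ofReal hΦi (Filter.Eventually.of_forall hΦ0)]
  exact ENNReal.ofReal_le_ofReal hΦint

end Convergence

theorem minimaxRetrainTime_le {d s : ℕ} {μ L e : ℝ} {D : Measure (Euc s)}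
    [IsProbabilityMeasure D] (hμ : 0 < μ) (hL : 0 < L) {N : ℕ} (hN : 0 < N)
    (he : 2 * L ^ 2 / (μ * (N + 1)) ≤ e) :
    minimaxRetrainTime d μ L D e ≤ ((N + 1 : ℕ) : ℕ∞) := by
  refine (iInf_le _ (averagedSGD d (L / (2 * μ)) (fun t => 2 / (μ * (t + 2)))
    (fun t => 2 * (t + 1) / (N * (N + 1))) N)).trans (iSup₂_le fun ℓ hℓ => ?_)
  exact iInf₂_le (N + 1) fun T hT => (averagedSGD_expectedExcess_le hℓ hμ hL hN hT).trans
    (ENNReal.ofReal_le_ofReal he)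

/-! ### Overlap of product distributions. -/

section Affinity

variable {α : Type*} [Fintype α]

/-- Cauchy–Schwarz applied to PQ = min(P, Q) · max(P, Q), where the maxima sum to 2 minus the sum of
the minima. -/
theorem sq_sum_sqrt_mul_le {P Q : α → ℝ} (hP : ∀ a, 0 ≤ P a) (hQ : ∀ a, 0 ≤ Q a)
    (hP1 : ∑ a, P a = 1) (hQ1 : ∑ a, Q a = 1) :
    (∑ a, √(P a * Q a)) ^ 2 ≤ (∑ a, min (P a) (Q a)) * (2 - ∑ a, min (P a) (Q a)) := by
  have hmax : ∑ a, max (P a) (Q a) = 2 - ∑ a, min (P a) (Q a) := by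
    rw [eq_sub_iff_add_eq, ← Finset.sum_add_distrib]
    simp only [max_add_min, Finset.sum_add_distrib, hP1, hQ1]
    norm_num
  have hmin0 : ∀ a, 0 ≤ min (P a) (Q a) := fun a => le_min (hP a) (hQ a)
  have hmax0 : ∀ a, 0 ≤ max (P a) (Q a) := fun a => (hP a).trans (le_max_left _ _)
  have h1 : ∑ a, √(P a * Q a) = ∑ a, √(min (P a) (Q a)) * √(max (P a) (Q a)) := by
    refine Finset.sum_congr rfl fun a _ => ?_
    rw [← Real.sqrt_mul (hmin0 a), min_mul_max]
  have h2 := Finset.sum_mul_sq_le_sq_mul_sq Finset.univ (fun a => √(min (P a) (Q a)))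
    (fun a => √(max (P a) (Q a)))
  simp only [Real.sq_sqrt (hmin0 _), Real.sq_sqrt (hmax0 _)] at h2
  rwa [h1, ← hmax]

/-- The overlap of two product distributions is bounded below through the Bhattacharyya
coefficient of the factors. -/
theorem one_sub_sqrt_le_sum_min_prod {p q : α → ℝ} (hp : ∀ a, 0 ≤ p a) (hq : ∀ a, 0 ≤ q a)
    (hp1 : ∑ a, p a = 1) (hq1 : ∑ a, q a = 1) (T : ℕ) :
    1 - √(1 - ((∑ a, √(p a * q a)) ^ 2) ^ T) ≤
      ∑ z : Fin T → α, min (∏ i, p (z i)) (∏ i, q (z i)) := by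
  set m := ∑ z : Fin T → α, min (∏ i, p (z i)) (∏ i, q (z i)) with hm
  have h1 := sq_sum_sqrt_mul_le (P := fun z : Fin T → α => ∏ i, p (z i))
    (Q := fun z : Fin T → α => ∏ i, q (z i)) (fun z => Finset.prod_nonneg fun i _ => hp _)
    (fun z => Finset.prod_nonneg fun i _ => hq _)
    (by rw [← Fintype.sum_pow, hp1, one_pow]) (by rw [← Fintype.sum_pow, hq1, one_pow])
  have h2 : ∑ z : Fin T → α, √((∏ i, p (z i)) * ∏ i, q (z i)) = (∑ a, √(p a * q a)) ^ T := by
    rw [Fintype.sum_pow]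
    refine Finset.sum_congr rfl fun z _ => ?_
    rw [← Finset.prod_mul_distrib, Real.sqrt_prod _ fun i _ => mul_nonneg (hp _) (hq _)]
  rw [h2, ← pow_mul, mul_comm T 2, pow_mul] at h1
  -- The Bhattacharyya coefficient is multiplicative over factors, and m(2 - m) = 1 - (1 - m)².
  have h3 : 1 - m ≤ √(1 - ((∑ a, √(p a * q a)) ^ 2) ^ T) := by
    refine Real.le_sqrt_of_sq_le ?_
    nlinarith
  linarith

end Affinity

/-! ### The hard instances: quadratics with a random sign. -/

/-- The sign `±1` of a bit. -/
def bitSign (b : Bool) : ℝ := if b then 1 else -1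

theorem abs_bitSign (b : Bool) : |bitSign b| = 1 := by cases b <;> simp [bitSign]

/-- The gradient at `θ` of the quadratic loss with a linear term whose sign is the bit `b`. -/
noncomputable def bitGradient {d : ℕ} (μ L : ℝ) (u : Euc d) (b : Bool) (θ : Euc d) : Euc d :=
  μ • θ + (L / 2 * bitSign b) • u

/-- A quadratic loss with a linear term along `u` whose sign depends on a bit of the data point. -/
noncomputable def bitLoss {d s : ℕ} (μ L : ℝ) (u : Euc d) (b : Euc s → Bool) (θ : Euc d)
    (ξ : Euc s) : ℝ :=
  μ / 2 * ‖θ‖ ^ 2 + L / 2 * bitSign (b ξ) * inner ℝ u θ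

section BitLoss

variable {d s : ℕ} {μ L : ℝ} {u : Euc d} {b : Euc s → Bool}

theorem hasGradientAt_bitLoss (θ : Euc d) (ξ : Euc s) :
    HasGradientAt (fun η => bitLoss μ L u b η ξ) (bitGradient μ L u (b ξ) θ) θ := by
  rw [hasGradientAt_iff_hasFDerivAt]
  have h1 := ((hasFDerivAt_id θ).norm_sq.const_mul (μ / 2)).add
    (((innerSL ℝ u).hasFDerivAt (x := θ)).const_mul (L / 2 * bitSign (b ξ)))
  refine h1.congr_fderiv ?_
  ext v
  simp [bitGradient]
  ring

theorem gradient_bitLoss (θ : Euc d) (ξ : Euc s) :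
    gradient (fun η => bitLoss μ L u b η ξ) θ = bitGradient μ L u (b ξ) θ :=
  (hasGradientAt_bitLoss θ ξ).gradient

theorem integrable_bitSign_comp {D : Measure (Euc s)} [IsProbabilityMeasure D]
    (hb : Measurable b) : Integrable (fun ξ => bitSign (b ξ)) D :=
  Integrable.of_bound ((measurable_of_countable bitSign).comp hb).aestronglyMeasurable 1
    (Filter.Eventually.of_forall fun ξ => by rw [Real.norm_eq_abs, abs_bitSign])

/-- Completing the square. The minimizer and the excess risk can be read off this form. -/
theorem risk_bitLoss {D : Measure (Euc s)} [IsProbabilityMeasure D] (hμ : 0 < μ)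
    (hu : ‖u‖ = 1) (hb : Measurable b) (θ : Euc d) :
    risk D (bitLoss μ L u b) θ
      = μ / 2 * ‖θ + (L / (2 * μ) * ∫ ξ, bitSign (b ξ) ∂D) • u‖ ^ 2
        - μ / 2 * (L / (2 * μ) * ∫ ξ, bitSign (b ξ) ∂D) ^ 2 := by
  have hi := integrable_bitSign_comp (D := D) hb
  have h1 : risk D (bitLoss μ L u b) θ
      = μ / 2 * ‖θ‖ ^ 2 + L / 2 * (∫ ξ, bitSign (b ξ) ∂D) * inner ℝ u θ := by
    simp only [risk, bitLoss]
    rw [integral_add (integrable_const _) ((hi.const_mul _).mul_const _), integral_const,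
      integral_mul_const, integral_const_mul]
    simp
  rw [h1, norm_add_sq_real, inner_smul_right, norm_smul, hu, mul_one, Real.norm_eq_abs, sq_abs,
    real_inner_comm]
  field_simp
  ring

theorem abs_integral_bitSign_le {D : Measure (Euc s)} [IsProbabilityMeasure D] :
    |∫ ξ, bitSign (b ξ) ∂D| ≤ 1 := by
  have := norm_integral_le_of_norm_le_const (μ := D) (f := fun ξ => bitSign (b ξ)) (C := 1)
    (Filter.Eventually.of_forall fun ξ => by rw [Real.norm_eq_abs, abs_bitSign])
  simpa using this

theorem risk_bitLoss_minimizer_le {D : Measure (Euc s)} [IsProbabilityMeasure D] (hμ : 0 < μ)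
    (hu : ‖u‖ = 1) (hb : Measurable b) (θ : Euc d) :
    risk D (bitLoss μ L u b) (-((L / (2 * μ) * ∫ ξ, bitSign (b ξ) ∂D) • u))
      ≤ risk D (bitLoss μ L u b) θ := by
  rw [risk_bitLoss hμ hu hb, risk_bitLoss hμ hu hb, neg_add_cancel]
  have : 0 ≤ μ / 2 * ‖θ + (L / (2 * μ) * ∫ ξ, bitSign (b ξ) ∂D) • u‖ ^ 2 := by positivity
  simp only [norm_zero]
  linarith

/-- On the ball of radius L/(2μ) the quadratic part is L/2-Lipschitz, which leaves L/2 for the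
linear part. The strong convexity inequality is an equality, and the minimizer has norm L/(2μ) times
the absolute mean sign, which is at most 1. -/
theorem stronglyConvexLoss_bitLoss {D : Measure (Euc s)} [IsProbabilityMeasure D] (hμ : 0 < μ)
    (hL : 0 < L) (hu : ‖u‖ = 1) (hb : Measurable b) :
    StronglyConvexLoss μ L D (bitLoss μ L u b) where
  measurable := by
    have h1 : Measurable fun p : Euc d × Euc s => bitSign (b p.2) :=
      (measurable_of_countable bitSign).comp (hb.comp measurable_snd)
    have h2 : Measurable fun p : Euc d × Euc s => inner ℝ u p.1 :=
      measurable_const.inner measurable_fst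
    exact ((measurable_fst.norm.pow_const 2).const_mul _).add ((h1.const_mul _).mul h2)
  differentiable ξ θ := (hasGradientAt_bitLoss θ ξ).differentiableAt
  lipschitz ξ θ hθ θ' hθ' := by
    rw [mem_closedBall_zero_iff] at hθ hθ'
    have h1 : bitLoss μ L u b θ ξ - bitLoss μ L u b θ' ξ =
        μ / 2 * ((‖θ‖ + ‖θ'‖) * (‖θ‖ - ‖θ'‖)) + L / 2 * bitSign (b ξ) * inner ℝ u (θ - θ') := by
      simp only [bitLoss, inner_sub_right]
      ring
    have h2 : |inner ℝ u (θ - θ')| ≤ ‖θ - θ'‖ := by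
      simpa [hu] using abs_real_inner_le_norm u (θ - θ')
    have h3 : |‖θ‖ - ‖θ'‖| ≤ ‖θ - θ'‖ := abs_norm_sub_norm_le θ θ'
    have h4 : μ / 2 * (‖θ‖ + ‖θ'‖) ≤ L / 2 := by
      have : μ / 2 * (L / (2 * μ) + L / (2 * μ)) = L / 2 := by field_simp; ring
      rw [← this]
      gcongr
    have h5 : μ / 2 * ((‖θ‖ + ‖θ'‖) * |‖θ‖ - ‖θ'‖|) ≤ L / 2 * ‖θ - θ'‖ := by
      rw [← mul_assoc]
      exact mul_le_mul h4 h3 (abs_nonneg _) (by positivity)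
    have h6 : L / 2 * |inner ℝ u (θ - θ')| ≤ L / 2 * ‖θ - θ'‖ :=
      mul_le_mul_of_nonneg_left h2 (by positivity)
    rw [h1]
    refine (abs_add_le _ _).trans ?_
    rw [abs_mul, abs_mul, abs_mul, abs_mul, abs_bitSign, mul_one, abs_of_pos (half_pos hμ),
      abs_of_pos (half_pos hL), abs_of_nonneg (add_nonneg (norm_nonneg θ) (norm_nonneg θ'))]
    linarith
  stronglyConvex ξ θ _ θ' _ := by
    rw [gradient_bitLoss, bitGradient, inner_add_left, inner_smul_left, inner_smul_left,
      norm_sub_sq_real]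
    simp only [bitLoss, inner_sub_right, conj_trivial, real_inner_self_eq_norm_sq,
      real_inner_comm θ θ']
    refine le_of_eq ?_
    rw [real_inner_comm θ' θ]
    ring
  integrable θ := by
    have hi := integrable_bitSign_comp (D := D) hb
    exact (integrable_const _).add ((hi.const_mul _).mul_const _)
  exists_minimizer := by
    refine ⟨-((L / (2 * μ) * ∫ ξ, bitSign (b ξ) ∂D) • u), ?_,
      risk_bitLoss_minimizer_le hμ hu hb⟩
    rw [mem_closedBall_zero_iff, norm_neg, norm_smul, hu, mul_one, Real.norm_eq_abs, abs_mul,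
      abs_of_pos (by positivity : 0 < L / (2 * μ))]
    exact mul_le_of_le_one_right (by positivity) abs_integral_bitSign_le

theorem excess_bitLoss {D : Measure (Euc s)} [IsProbabilityMeasure D] (hμ : 0 < μ)
    (hu : ‖u‖ = 1) (hb : Measurable b) (θ : Euc d) :
    risk D (bitLoss μ L u b) θ - ⨅ η, risk D (bitLoss μ L u b) η
      = μ / 2 * ‖θ + (L / (2 * μ) * ∫ ξ, bitSign (b ξ) ∂D) • u‖ ^ 2 := by
  have hmin := risk_bitLoss_minimizer_le (L := L) (D := D) hμ hu hb
  have hinf : ⨅ η, risk D (bitLoss μ L u b) η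
      = risk D (bitLoss μ L u b) (-((L / (2 * μ) * ∫ ξ, bitSign (b ξ) ∂D) • u)) :=
    le_antisymm (ciInf_le ⟨_, Set.forall_mem_range.2 hmin⟩ _) (le_ciInf hmin)
  rw [hinf, risk_bitLoss hμ hu hb θ, risk_bitLoss hμ hu hb, neg_add_cancel]
  simp

end BitLoss

/-! ### Reduction of the algorithm's input to a bit string. -/

/-- State after `t` steps of an algorithm that is fed the gradients `bitGradient` along a sequence
of bits. -/
noncomputable def bitState {d : ℕ} (A : FirstOrderAlgorithm d) (μ L : ℝ) (u : Euc d)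
    (z : ℕ → Bool) (ω : A.Seed) : ℕ → Euc d × A.Mem
  | 0 => (0, A.initMem)
  | t + 1 => A.update ((bitState A μ L u z ω t).1,
      bitGradient μ L u (z t) (bitState A μ L u z ω t).1, (bitState A μ L u z ω t).2, ω)

section BitState

variable {d s : ℕ} {A : FirstOrderAlgorithm d} {μ L : ℝ} {u : Euc d}

/-- The gradient at a known θ depends on the data point only through its bit, so the trajectory is a
function of the bits and the seed alone. -/
theorem state_bitLoss (b : Euc s → Bool) (ξ : ℕ → Euc s) (ω : A.Seed) :
    ∀ t, A.state (bitLoss μ L u b) ξ ω t = bitState A μ L u (fun i => b (ξ i)) ω t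
  | 0 => rfl
  | t + 1 => by
      simp only [FirstOrderAlgorithm.state, bitState, state_bitLoss b ξ ω t, gradient_bitLoss]

theorem bitState_congr {z z' : ℕ → Bool} (ω : A.Seed) :
    ∀ {t : ℕ}, (∀ i < t, z i = z' i) → bitState A μ L u z ω t = bitState A μ L u z' ω t
  | 0, _ => rfl
  | t + 1, h => by
      have := bitState_congr ω (t := t) fun i hi => h i (by omega)
      simp only [bitState, this, h t (by omega)]

theorem measurable_bitState :
    ∀ t, Measurable fun p : (ℕ → Bool) × A.Seed => bitState A μ L u p.1 p.2 t
  | 0 => measurable_const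
  | t + 1 => by
      have ih := measurable_bitState t
      have hb : Measurable fun p : (ℕ → Bool) × A.Seed => bitSign (p.1 t) :=
        (measurable_of_countable bitSign).comp ((measurable_pi_apply t).comp measurable_fst)
      have hg : Measurable fun p : (ℕ → Bool) × A.Seed =>
          bitGradient μ L u (p.1 t) (bitState A μ L u p.1 p.2 t).1 :=
        (ih.fst.const_smul μ).add ((hb.const_mul _).smul_const u)
      exact A.measurable_update.comp (ih.fst.prodMk (hg.prodMk (ih.snd.prodMk measurable_snd)))

end BitState

/-- Extension of a finite bit sequence by `false`. -/
def extendBits {T : ℕ} (z : Fin T → Bool) (i : ℕ) : Bool :=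
  if h : i < T then z ⟨i, h⟩ else false

theorem infinitePi_bits_eq {s T : ℕ} {D : Measure (Euc s)} [IsProbabilityMeasure D]
    {b : Euc s → Bool} (hb : Measurable b) (z : Fin T → Bool) :
    (Measure.infinitePi fun _ : ℕ => D).map (fun ξ (i : Fin T) => b (ξ i)) {z}
      = ∏ i, D (b ⁻¹' {z i}) := by
  have hm : Measurable fun (ξ : ℕ → Euc s) (i : Fin T) => b (ξ i) :=
    measurable_pi_lambda _ fun i => hb.comp (measurable_pi_apply _)
  rw [Measure.map_apply hm (measurableSet_singleton z)]
  have h1 : (fun (ξ : ℕ → Euc s) (i : Fin T) => b (ξ i)) ⁻¹' {z}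
      = Set.pi (Finset.range T) fun i => b ⁻¹' {extendBits z i} := by
    ext ξ
    simp only [Set.mem_preimage, Set.mem_singleton_iff, funext_iff, Set.mem_pi, Finset.coe_range,
      Set.mem_Iio]
    refine ⟨fun h i hi => by simp [extendBits, hi, ← h], fun h i => ?_⟩
    simpa [extendBits] using h i i.2
  rw [h1, Measure.infinitePi_pi _ fun i _ => hb (measurableSet_singleton _), Finset.prod_range]
  simp [extendBits]

section LowerBound

variable {d s : ℕ} {μ L : ℝ} {u : Euc d} {D : Measure (Euc s)} [IsProbabilityMeasure D]

/-- Only the first T bits matter at time T, so the integral over infinite data sequences becomes a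
finite sum with product weights, the form needed for the overlap bound. -/
theorem expectedExcess_bitLoss (A : FirstOrderAlgorithm d) (hμ : 0 < μ) (hu : ‖u‖ = 1)
    {b : Euc s → Bool} (hb : Measurable b) (T : ℕ) :
    A.expectedExcess D (bitLoss μ L u b) T = ∑ z : Fin T → Bool,
      (∫⁻ ω, ENNReal.ofReal (μ / 2 * ‖(bitState A μ L u (extendBits z) ω T).1
        + (L / (2 * μ) * ∫ ξ, bitSign (b ξ) ∂D) • u‖ ^ 2) ∂A.seedLaw)
        * ∏ i, D (b ⁻¹' {z i}) := by
  set v := (L / (2 * μ) * ∫ ξ, bitSign (b ξ) ∂D) • u with hv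
  have hbξ : Measurable fun ξ : ℕ → Euc s => fun i => b (ξ i) :=
    measurable_pi_lambda _ fun i => hb.comp (measurable_pi_apply i)
  have hbits : Measurable fun (ξ : ℕ → Euc s) (i : Fin T) => b (ξ i) :=
    measurable_pi_lambda _ fun i => hb.comp (measurable_pi_apply _)
  simp only [FirstOrderAlgorithm.expectedExcess, excess_bitLoss hμ hu hb, ← hv, state_bitLoss]
  rw [lintegral_prod]
  · have h1 : ∀ ξ : ℕ → Euc s, ∀ ω : A.Seed, bitState A μ L u (fun i => b (ξ i)) ω T
        = bitState A μ L u (extendBits fun i : Fin T => b (ξ i)) ω T := fun ξ ω =>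
      bitState_congr ω fun i hi => by simp [extendBits, hi]
    simp only [h1]
    rw [← lintegral_map (f := fun z : Fin T → Bool => ∫⁻ ω, ENNReal.ofReal (μ / 2 *
      ‖(bitState A μ L u (extendBits z) ω T).1 + v‖ ^ 2) ∂A.seedLaw)
      (measurable_of_countable _) hbits, lintegral_fintype]
    simp only [infinitePi_bits_eq hb]
  · have h2 := (measurable_bitState (A := A) (μ := μ) (L := L) (u := u) T).comp
      ((hbξ.comp measurable_fst).prodMk measurable_snd)
    exact (((h2.fst.add_const v).norm.pow_const 2).const_mul _).ennreal_ofReal.aemeasurable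

end LowerBound

/-! ### Le Cam's two-point argument. -/

section Separation

variable {d s : ℕ} {μ L : ℝ} {u : Euc d} {D : Measure (Euc s)} [IsProbabilityMeasure D]

theorem bitSign_not (b : Bool) : bitSign (!b) = -bitSign b := by cases b <;> simp [bitSign]

theorem integral_bitSign_of_measure {b : Euc s → Bool} (hb : Measurable b) {q : Bool → ℝ}
    (hq : ∀ x, 0 ≤ q x) (hD : ∀ x, D (b ⁻¹' {x}) = ENNReal.ofReal (q x)) :
    ∫ ξ, bitSign (b ξ) ∂D = q true - q false := by
  have : IsProbabilityMeasure (D.map b) := Measure.isProbabilityMeasure_map hb.aemeasurable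
  rw [← integral_map (f := bitSign) hb.aemeasurable
    (measurable_of_countable bitSign).aestronglyMeasurable, integral_fintype Integrable.of_finite]
  simp [Measure.real, Measure.map_apply hb, hD, hq, bitSign, sub_eq_add_neg]

/-- Two losses whose data bits have biases `ε` and `-ε` cannot both be learned well in `T` steps. -/
theorem le_expectedExcess_add_expectedExcess (A : FirstOrderAlgorithm d) (hμ : 0 < μ)
    (hu : ‖u‖ = 1) {ε : ℝ} (hε0 : 0 ≤ ε) (hε1 : ε ≤ 1) {b : Euc s → Bool} (hb : Measurable b)
    (hD : ∀ x, D (b ⁻¹' {x}) = ENNReal.ofReal ((1 + bitSign x * ε) / 2)) (T : ℕ) :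
    ENNReal.ofReal (L ^ 2 * ε ^ 2 / (4 * μ) * (1 - √(1 - (1 - ε ^ 2) ^ T))) ≤
      A.expectedExcess D (bitLoss μ L u b) T
        + A.expectedExcess D (bitLoss μ L u fun ξ => !(b ξ)) T := by
  have hb' : Measurable fun ξ => !(b ξ) := (measurable_of_countable not).comp hb
  set p : Bool → ℝ := fun x => (1 + bitSign x * ε) / 2 with hp
  set q : Bool → ℝ := fun x => (1 - bitSign x * ε) / 2 with hq
  have hp0 : ∀ x, 0 ≤ p x := by
    intro x; cases x <;> simp only [hp, bitSign] <;> norm_num <;> linarith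
  have hq0 : ∀ x, 0 ≤ q x := by
    intro x; cases x <;> simp only [hq, bitSign] <;> norm_num <;> linarith
  have hp1 : ∑ x, p x = 1 := by simp [hp, bitSign]; ring
  have hq1 : ∑ x, q x = 1 := by simp [hq, bitSign]; ring
  have hDp : ∀ x, D (b ⁻¹' {x}) = ENNReal.ofReal (p x) := hD
  have hD' : ∀ x, D ((fun ξ => !(b ξ)) ⁻¹' {x}) = ENNReal.ofReal (q x) := by
    intro x
    have : (fun ξ => !(b ξ)) ⁻¹' {x} = b ⁻¹' {!x} := by
      ext ξ; simp [Bool.not_eq_eq_eq_not]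
    rw [this, hD, bitSign_not]
    simp only [hq]
    ring_nf
  have hm : ∫ ξ, bitSign (b ξ) ∂D = ε := by
    rw [integral_bitSign_of_measure hb hp0 hD]; simp [hp, bitSign]; ring
  have hm' : ∫ ξ, bitSign (!(b ξ)) ∂D = -ε := by
    simp only [bitSign_not, integral_neg, hm]
  rw [expectedExcess_bitLoss A hμ hu hb, expectedExcess_bitLoss A hμ hu hb', hm, hm']
  simp only [hDp, hD', ← ENNReal.ofReal_prod_of_nonneg fun i _ => hp0 _,
    ← ENNReal.ofReal_prod_of_nonneg fun i _ => hq0 _]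
  rw [← Finset.sum_add_distrib]
  set K := L ^ 2 * ε ^ 2 / (4 * μ) with hK
  have hK0 : 0 ≤ K := by positivity
  have hov := one_sub_sqrt_le_sum_min_prod hp0 hq0 hp1 hq1 T
  -- Both products p x · q x equal (1 - ε²)/4, so the single-bit Bhattacharyya coefficient is √(1 -
  -- ε²).
  have hbc : (∑ x, √(p x * q x)) ^ 2 = 1 - ε ^ 2 := by
    have h1 : ∀ x, p x * q x = (1 - ε ^ 2) / 4 := by
      intro x; cases x <;> simp [hp, hq, bitSign] <;> ring
    simp only [h1, Fintype.sum_bool]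
    have h2 : 0 ≤ (1 - ε ^ 2) / 4 := by nlinarith
    linear_combination 4 * Real.sq_sqrt h2
  rw [hbc] at hov
  refine (ENNReal.ofReal_le_ofReal (mul_le_mul_of_nonneg_left hov hK0)).trans ?_
  rw [Finset.mul_sum, ENNReal.ofReal_sum_of_nonneg fun z _ => mul_nonneg hK0
    (le_min (Finset.prod_nonneg fun i _ => hp0 _) (Finset.prod_nonneg fun i _ => hq0 _))]
  -- Given the observed bit string z and the seed, the model is the same for both losses. Only the
  -- probabilities P and Q of z and the target minimizer differ.
  refine Finset.sum_le_sum fun z _ => ?_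
  set P := ∏ i, p (z i)
  set Q := ∏ i, q (z i)
  have hmeas : Measurable fun ω : A.Seed => (bitState A μ L u (extendBits z) ω T).1 :=
    ((measurable_bitState T).comp (measurable_const.prodMk measurable_id)).fst
  -- Parallelogram identity: the cross terms cancel and μ‖θ‖² is dropped.
  have hsep : ∀ θ : Euc d, K ≤ μ / 2 * ‖θ + (L / (2 * μ) * ε) • u‖ ^ 2
      + μ / 2 * ‖θ + (L / (2 * μ) * -ε) • u‖ ^ 2 := by
    intro θ
    have h2 : K = μ * (L / (2 * μ) * ε) ^ 2 := by rw [hK]; field_simp; ring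
    rw [norm_add_sq_real, norm_add_sq_real, inner_smul_right, inner_smul_right, norm_smul,
      norm_smul, hu, mul_one, mul_one, Real.norm_eq_abs, Real.norm_eq_abs, sq_abs, sq_abs, h2]
    have : 0 ≤ μ * ‖θ‖ ^ 2 := by positivity
    linarith
  rw [mul_comm K, ENNReal.ofReal_mul (le_min (Finset.prod_nonneg fun i _ => hp0 _)
    (Finset.prod_nonneg fun i _ => hq0 _))]
  calc ENNReal.ofReal (min P Q) * ENNReal.ofReal K
      ≤ ENNReal.ofReal (min P Q) * ∫⁻ ω, (ENNReal.ofReal (μ / 2 *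
          ‖(bitState A μ L u (extendBits z) ω T).1 + (L / (2 * μ) * ε) • u‖ ^ 2)
        + ENNReal.ofReal (μ / 2 *
          ‖(bitState A μ L u (extendBits z) ω T).1 + (L / (2 * μ) * -ε) • u‖ ^ 2))
          ∂A.seedLaw := by
        gcongr
        refine le_trans (by simp) (lintegral_mono (f := fun _ => ENNReal.ofReal K) fun ω => ?_)
        rw [← ENNReal.ofReal_add (by positivity) (by positivity)]
        exact ENNReal.ofReal_le_ofReal (hsep _)
    _ ≤ _ := by
        rw [lintegral_add_left
          (((hmeas.add_const _).norm.pow_const 2).const_mul _).ennreal_ofReal, mul_add, mul_comm,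
          mul_comm (ENNReal.ofReal (min P Q))]
        gcongr
        · exact min_le_left _ _
        · exact min_le_right _ _

/-- The retraining time asks for small excess at all later times, so a failure at T excludes every
threshold up to T. -/
theorem add_one_le_retrainTime {A : FirstOrderAlgorithm d} {e : ℝ} {ℓ : Euc d → Euc s → ℝ} {T : ℕ}
    (h : ENNReal.ofReal e < A.expectedExcess D ℓ T) :
    ((T + 1 : ℕ) : ℕ∞) ≤ A.retrainTime D e ℓ := by
  refine le_iInf₂ fun T' hT' => ?_
  by_contra hlt
  have hle : T' ≤ T := by
    rw [not_le, Nat.cast_lt] at hlt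
    omega
  exact absurd (hT' T hle) (not_le.2 h)

theorem add_one_le_minimaxRetrainTime (hd : 0 < d) (hμ : 0 < μ) (hL : 0 < L)
    (hflex : ∀ p ∈ Set.Icc (0 : ℝ) 1, ∃ A : Set (Euc s), MeasurableSet A ∧
      D A = ENNReal.ofReal p) {e ε : ℝ} (he : 0 ≤ e) (hε0 : 0 ≤ ε) (hε1 : ε ≤ 1) {T : ℕ}
    (hlt : e < L ^ 2 / (8 * μ) * ε ^ 2 * (1 - √(1 - (1 - ε ^ 2) ^ T))) :
    ((T + 1 : ℕ) : ℕ∞) ≤ minimaxRetrainTime d μ L D e := by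
  classical
  obtain ⟨B, hB, hDB⟩ := hflex ((1 + ε) / 2) ⟨by linarith, by linarith⟩
  set b : Euc s → Bool := fun ξ => decide (ξ ∈ B) with hbdef
  have htrue : b ⁻¹' {true} = B := by ext ξ; simp [hbdef]
  have hfalse : b ⁻¹' {false} = Bᶜ := by ext ξ; simp [hbdef]
  have hb : Measurable b := measurable_to_bool (by rw [htrue]; exact hB)
  have hD : ∀ x, D (b ⁻¹' {x}) = ENNReal.ofReal ((1 + bitSign x * ε) / 2) := by
    intro x
    cases x
    · rw [hfalse, prob_compl_eq_one_sub hB, hDB, ← ENNReal.ofReal_one,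
        ← ENNReal.ofReal_sub _ (by linarith)]
      congr 1
      simp only [bitSign]
      norm_num
      ring
    · rw [htrue, hDB]
      simp [bitSign]
  have hb' : Measurable fun ξ => !(b ξ) := (measurable_of_countable not).comp hb
  set u : Euc d := EuclideanSpace.single ⟨0, hd⟩ 1
  have hu : ‖u‖ = 1 := by simp [u]
  refine le_iInf fun A => ?_
  have hsum := le_expectedExcess_add_expectedExcess (L := L) A hμ hu hε0 hε1 hb hD T
  have hbig : ENNReal.ofReal e + ENNReal.ofReal e < A.expectedExcess D (bitLoss μ L u b) T
      + A.expectedExcess D (bitLoss μ L u fun ξ => !(b ξ)) T := by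
    refine lt_of_lt_of_le ?_ hsum
    rw [← ENNReal.ofReal_add he he, ENNReal.ofReal_lt_ofReal_iff_of_nonneg (by linarith)]
    have : L ^ 2 * ε ^ 2 / (4 * μ) * (1 - √(1 - (1 - ε ^ 2) ^ T))
        = 2 * (L ^ 2 / (8 * μ) * ε ^ 2 * (1 - √(1 - (1 - ε ^ 2) ^ T))) := by
      field_simp
      ring
    linarith
  -- The two excesses sum to more than 2e. The losses are fixed independently of A; which one is bad
  -- may depend on A.
  have hone : ENNReal.ofReal e < A.expectedExcess D (bitLoss μ L u b) T ∨
      ENNReal.ofReal e < A.expectedExcess D (bitLoss μ L u fun ξ => !(b ξ)) T := by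
    by_contra hc
    push Not at hc
    exact absurd (add_le_add hc.1 hc.2) (not_le.2 hbig)
  rcases hone with h | h
  · exact (add_one_le_retrainTime h).trans
      (le_iSup₂_of_le _ (stronglyConvexLoss_bitLoss hμ hL hu hb) le_rfl)
  · exact (add_one_le_retrainTime h).trans
      (le_iSup₂_of_le _ (stronglyConvexLoss_bitLoss hμ hL hu hb') le_rfl)

end Separation

/-! ### Choice of constants. -/

theorem lemma3 :
    ∃ c C : ℝ, 0 < c ∧ 0 < C ∧
      ∀ (d s : ℕ) (μ L e : ℝ) (Dr Df : Measure (Euc s))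
        [IsProbabilityMeasure Dr] [IsProbabilityMeasure Df],
        0 < d → 0 < μ → 0 < L → FlexibleDistributions Dr Df →
        0 < e → e < L ^ 2 / (8 * μ) →
        ∃ T : ℕ, minimaxRetrainTime d μ L Dr e = (T : ℕ∞) ∧
          c * (L ^ 2 / (8 * μ) / e) ≤ (T : ℝ) ∧
          (T : ℝ) ≤ C * (L ^ 2 / (8 * μ) / e) := by
  -- The rate 2L²/(μ(N+1)) = 16 e₀/(N+1) suggests N = ⌈16x⌉, and N + 1 < 16x + 2 ≤ 18x since x > 1.
  -- The value 1/16 makes Tε² < 1/4 when ε² = 4/x.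
  refine ⟨1 / 16, 18, by norm_num, by norm_num, ?_⟩
  intro d s μ L e Dr Df _ _ hd hμ hL hflex he hlt
  set x := L ^ 2 / (8 * μ) / e with hx
  have hxe : x * e = L ^ 2 / (8 * μ) := div_mul_cancel₀ _ he.ne'
  have hx1 : 1 < x := (one_lt_div he).2 hlt
  have hN : 0 < ⌈16 * x⌉₊ := Nat.ceil_pos.2 (by linarith)
  have hupper : minimaxRetrainTime d μ L Dr e ≤ ((⌈16 * x⌉₊ + 1 : ℕ) : ℕ∞) := by
    refine minimaxRetrainTime_le hμ hL hN ?_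
    have h1 : 16 * x ≤ ⌈16 * x⌉₊ := Nat.le_ceil _
    have h2 : 2 * L ^ 2 = 16 * x * e * μ := by
      rw [mul_assoc 16, hxe]; field_simp; ring
    rw [div_le_iff₀ (by positivity), h2]
    have h3 : 0 < e * μ := by positivity
    nlinarith
  obtain ⟨T, hT⟩ := ENat.ne_top_iff_exists.1 (ne_top_of_le_ne_top (ENat.natCast_ne_top _) hupper)
  refine ⟨T, hT.symm, ?_, ?_⟩
  · by_contra hc
    push Not at hc
    suffices h : ((T + 1 : ℕ) : ℕ∞) ≤ minimaxRetrainTime d μ L Dr e by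
      rw [← hT, Nat.cast_le] at h
      omega
    -- For T = 0 there is no data, so full bias ε = 1 is allowed and the excess e₀ > e is
    -- unavoidable. For T ≥ 1, the assumption T < x/16 forces x > 16, so ε² = 4/x ≤ 1.
    rcases Nat.eq_zero_or_pos T with rfl | hTpos
    · exact add_one_le_minimaxRetrainTime hd hμ hL hflex.1 he.le (ε := 1) zero_le_one le_rfl
        (by simpa using hlt)
    · have hT1 : (1 : ℝ) ≤ T := by exact_mod_cast hTpos
      have hx0 : 0 < x := by linarith
      have hsq : √(4 / x) ^ 2 = 4 / x := Real.sq_sqrt (by positivity)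
      have h4 : 4 / x ≤ 1 := by rw [div_le_one hx0]; linarith
      refine add_one_le_minimaxRetrainTime hd hμ hL hflex.1 he.le (ε := √(4 / x))
        (Real.sqrt_nonneg _) (by rw [Real.sqrt_le_one]; exact h4) ?_
      rw [hsq]
      -- By Bernoulli's inequality the square root is below 1/2. Since e₀ε² = 4e, the lower bound
      -- exceeds 4e · 1/2 > e.
      have h5 : (1 : ℝ) - T * (4 / x) ≤ (1 - 4 / x) ^ T := by
        have := one_add_mul_le_pow (a := -(4 / x)) (by linarith) T
        rw [← sub_eq_add_neg] at this
        linarith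
      have h6 : T * (4 / x) < 1 / 4 := by
        rw [← mul_div_assoc, div_lt_iff₀ hx0]; linarith
      have h7 : √(1 - (1 - 4 / x) ^ T) < 1 / 2 := by
        rw [Real.sqrt_lt' (by norm_num)]
        norm_num
        linarith
      have h8 : L ^ 2 / (8 * μ) * (4 / x) = 4 * e := by rw [← hxe]; field_simp
      rw [h8]
      nlinarith
  · rw [← hT, Nat.cast_le] at hupper
    have h1 : (T : ℝ) ≤ ⌈16 * x⌉₊ + 1 := by exact_mod_cast hupper
    have h2 := Nat.ceil_lt_add_one (a := 16 * x) (by linarith)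
    linarith
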